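/- Let $K$ be a field, let $n\ge 0$, and let $R=K[x_0,\dots,x_n]$. Order the monomials of each degree lexicographically with $x_0>\cdots>x_n$. An ideal of $R$ is called lexsegment if it is generated by monomials and, for all monomials $u,v$ of the same degree with $u\le v$, $u\in I$ implies $v\in I$. For a homogeneous ideal $I\subset R$ the Hilbert function of $R/I$ is $d\mapsto\dim_K[R/I]_d$, and the $q$-th total Betti number of $I$ is $\beta_q(I)=\dim_K\operatorname{Tor}_q^R(I,K)$, where $K=R/(x_0,\dots,x_n)$. For a function $h$ that is the Hilbert function of a quotient of $R$ by a homogeneous ideal, let $L_h\subset R$ denote the lexsegment ideal such that $R/L_h$ has Hilbert function $h$ (by a theorem of Macaulay there is exactly one). For a monomial $m=x_0^{a_0}\cdots x_n^{a_n}$ put $\operatorname{maxi}(m)=\max\{i\mid a_i>0\}$, with $\operatorname{maxi}(1)=0$. For $d\ge 0$ let $R_d[k]$ be the $k$-th lexicographically last monomial of degree $d$ in $R$ (so $R_d[1]=x_n^d$), and put $$V_q[d,\ell]=\sum_{k=1}^{\ell}\left(\binom{n+1}{q+1}-\binom{\operatorname{maxi}(R_d[k])+1}{q+1}\right).$$ Let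 $\Delta h$ and $\overline{\Delta h}$ be Hilbert functions of such quotients of $R$, and let $D$ be an integer such that $\Delta h(d)=\overline{\Delta h}(d)$ for all $d>D$. Then for every $q\ge 0$ $$\beta_q\left(L_{\Delta h}\right)=\beta_q\left(L_{\overline{\Delta h}}\right)+\sum_{d=0}^{D}V_q[d,\Delta h(d)]-\sum_{d=0}^{D}V_q[d,\overline{\Delta h}(d)],$$ where the sums are empty if $D<0$. -/

import Mathlib

open CategoryTheory

noncomputable section

namespace LexBetti

universe u

/-- The polynomial ring `R = K[x_0, …, x_n]`, in `n + 1` variables. -/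
abbrev PolyRing (K : Type u) [Field K] (n : ℕ) : Type u :=
  MvPolynomial (Fin (n + 1)) K

/-- The residue field `K = R / (x_0, …, x_n)`, as an `R`-module. -/
abbrev ResidueModule (K : Type u) [Field K] (n : ℕ) : Type u :=
  PolyRing K n ⧸ Ideal.span (Set.range (MvPolynomial.X : Fin (n + 1) → PolyRing K n))

/-- The `q`-th total Betti number `β_q(I) = dim_K Tor_q^R(I, K)` of an ideal `I` of
`R = K[x_0, …, x_n]`, regarded as an `R`-module. -/
def betti {K : Type u} [Field K] {n : ℕ} (q : ℕ) (I : Ideal (PolyRing K n)) : ℕ :=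
  Module.finrank K
    ((ModuleCat.restrictScalars (algebraMap K (PolyRing K n))).obj
      (((Tor (ModuleCat.{u} (PolyRing K n)) q).obj (ModuleCat.of (PolyRing K n) I)).obj
        (ModuleCat.of (PolyRing K n) (ResidueModule K n))))

/-- The Hilbert function `d ↦ dim_K [R/I]_d` of `R/I`, where `[R/I]_d` is the image in `R/I` of
the space of homogeneous polynomials of degree `d`. -/
def hilbertFunction {K : Type u} [Field K] {n : ℕ} (I : Ideal (PolyRing K n)) (d : ℕ) : ℕ :=
  Module.finrank K
    ((MvPolynomial.homogeneousSubmodule (Fin (n + 1)) K d).map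
      (Ideal.Quotient.mkₐ K I).toLinearMap)

/-- A lexsegment ideal: it is generated by monomials, and in each degree its monomials form an
initial segment (from the top) for the lexicographic order with `x_0 > ⋯ > x_n`.
(In `Lex (Fin (n + 1) →₀ ℕ)` exponent vectors are compared at the first index where they
differ, so that `x_0` is the largest variable.) -/
structure IsLexsegment {K : Type u} [Field K] {n : ℕ} (I : Ideal (PolyRing K n)) : Prop where
  span_monomials :
    Ideal.span {p | p ∈ I ∧ ∃ a : Fin (n + 1) →₀ ℕ, p = MvPolynomial.monomial a 1} = I
  mem_of_lex_le : ∀ a b : Fin (n + 1) →₀ ℕ, a.degree = b.degree → toLex a ≤ toLex b →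
    MvPolynomial.monomial a 1 ∈ I → MvPolynomial.monomial b 1 ∈ I

/-- `maxi(x_0^{a_0} ⋯ x_n^{a_n}) = max {i | a_i > 0}`, with `maxi(1) = 0`. -/
def maxi {n : ℕ} (a : Fin (n + 1) →₀ ℕ) : ℕ :=
  a.support.sup fun i => (i : ℕ)

/-- The exponent vectors of the monomials of degree `d` in `x_0, …, x_n`. -/
def monomialsOfDegree (n d : ℕ) : Finset (Fin (n + 1) →₀ ℕ) :=
  Finset.univ.finsuppAntidiag d

open Classical in
/-- The `ℓ` lexicographically last monomials `R_d[1], …, R_d[ℓ]` of degree `d`: those with fewer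
than `ℓ` lexicographically smaller monomials of the same degree. -/
def lastMonomials (n d ℓ : ℕ) : Finset (Fin (n + 1) →₀ ℕ) :=
  (monomialsOfDegree n d).filter fun a =>
    ((monomialsOfDegree n d).filter fun b => toLex b < toLex a).card < ℓ

/-- `V_q[d, ℓ]`, the sum of `binom(n+1, q+1) - binom(maxi(m)+1, q+1)` over the `ℓ`
lexicographically last monomials `m` of degree `d` in `x_0, …, x_n`. -/
def V (n q d ℓ : ℕ) : ℤ :=
  ∑ a ∈ lastMonomials n d ℓ,
    (((n + 1).choose (q + 1) : ℤ) - ((maxi a + 1).choose (q + 1) : ℤ))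

end LexBetti

end

/-! A lexsegment ideal is strongly stable: replacing a variable of a monomial in the ideal by one of
smaller index gives a lexicographically larger monomial. For a strongly stable ideal `I` with set of
exponents `S`, Tor is computed from `I` tensored with the Koszul complex of the variables. This
complex has a `K`-basis of pairs `(F, a)`, with `F` a set of indices and `a ∈ S`.

Pair `(G ∪ {m}, c)` with `(G, c + e_m)` whenever `m` exceeds every element of `G` and bounds all
indices occurring in `c ∈ S`. On the span of the paired elements this matching gives an explicit
contracting homotopy (`koszul_homotopy`). Every term of a boundary is paired (`isMatched_erase`), so
the homology has a basis indexed by the unpaired elements. These are the `(F, a)` with `a` a minimal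
generator and all elements of `F` below `maxi a` (`mem_criticalSet_iff`). This is the
Eliahou–Kervaire formula: `β_q` is the sum of `binom(maxi a, q)` over the minimal generators. The
case where `S` is everything shows that the Koszul complex resolves the residue field, so one
matching serves twice.

A monomial of `S` in degree `d + 1` that is not a minimal generator is uniquely `c * x_m` with `c ∈
S` of degree `d` and `m ≥ maxi c`. Hence generators are counted by differences of sums over all
monomials of `S` in consecutive degrees (`genSum_succ`), and these telescope (`sum_genSum`). Outside
`S` lie exactly the `h(d)` last monomials of degree `d`. So for large `N`, `β_q` is a term depending
only on `n`, `q`, `N` and `h(N)`, plus the sum of the `V_q[d, h(d)]` for `d < N`. Comparing two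
Hilbert functions that agree beyond `D` cancels everything except the degrees up to `D`. -/

noncomputable section

namespace LexBetti

open MvPolynomial

set_option linter.unusedSectionVars false

/-! ### The Koszul complex of the variables and its monomial basis -/

section Koszul

variable {K σ : Type*} [Field K] [Fintype σ] [LinearOrder σ]

/-- The sign with which the index `i` is removed from the set `F`. -/
def koszulSign (i : σ) (F : Finset σ) : ℤ := (-1) ^ (F.filter (i < ·)).card

variable (K σ) in
/-- The differential of the Koszul complex of the variables of `MvPolynomial σ K`, on the
direct sum of all its terms, with basis the subsets of `σ`. -/
def koszulD : (Finset σ → MvPolynomial σ K) →ₗ[MvPolynomial σ K] (Finset σ → MvPolynomial σ K) :=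
  ∑ F : Finset σ, ∑ i ∈ F, koszulSign i F •
    (LinearMap.single (MvPolynomial σ K) (fun _ : Finset σ => MvPolynomial σ K) (F.erase i)) ∘ₗ
      (LinearMap.lsmul (MvPolynomial σ K) (MvPolynomial σ K) (X i)) ∘ₗ LinearMap.proj F

theorem koszulD_single (F : Finset σ) (p : MvPolynomial σ K) :
    koszulD K σ (Pi.single F p) = ∑ i ∈ F, koszulSign i F • Pi.single (F.erase i) (X i * p) := by
  rw [koszulD, LinearMap.sum_apply, Finset.sum_eq_single F]
  · simp [LinearMap.sum_apply]
  · intro G _ hG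
    simp [LinearMap.sum_apply, Pi.single_eq_of_ne hG]
  · simp

/-- The sign of an index counts the larger elements. Removing `i` leaves the count for `j`
unchanged, while removing `j` lowers the count for `i` by one. -/
theorem koszulSign_mul_erase_of_lt {F : Finset σ} {i j : σ} (hj : j ∈ F) (hij : i < j) :
    koszulSign i F * koszulSign j (F.erase i) =
      -(koszulSign j F * koszulSign i (F.erase j)) := by
  have h1 : (F.erase i).filter (j < ·) = F.filter (j < ·) := by
    ext k
    simp only [Finset.mem_filter, Finset.mem_erase]
    exact ⟨fun h => ⟨h.1.2, h.2⟩, fun h => ⟨⟨(hij.trans h.2).ne', h.1⟩, h.2⟩⟩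
  have h2 : F.filter (i < ·) = insert j ((F.erase j).filter (i < ·)) := by
    ext k
    simp only [Finset.mem_filter, Finset.mem_erase, Finset.mem_insert]
    by_cases hk : k = j
    · subst hk; simp [hj, hij]
    · simp [hk]
  have h3 : (F.filter (i < ·)).card = ((F.erase j).filter (i < ·)).card + 1 := by
    rw [h2, Finset.card_insert_of_notMem (by simp)]
  simp only [koszulSign, h1, h3]
  ring

theorem koszulSign_mul_erase {F : Finset σ} {i j : σ} (hi : i ∈ F) (hj : j ∈ F) (hij : i ≠ j) :
    koszulSign i F * koszulSign j (F.erase i) =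
      -(koszulSign j F * koszulSign i (F.erase j)) := by
  rcases lt_or_gt_of_ne hij with h | h
  · exact koszulSign_mul_erase_of_lt hj h
  · rw [koszulSign_mul_erase_of_lt hi h, neg_neg]

theorem koszulD_koszulD (f : Finset σ → MvPolynomial σ K) : koszulD K σ (koszulD K σ f) = 0 := by
  suffices h : koszulD K σ ∘ₗ koszulD K σ = 0 from DFunLike.congr_fun h f
  refine LinearMap.pi_ext fun F p => ?_
  simp only [LinearMap.comp_apply, koszulD_single, map_sum, map_zsmul, LinearMap.zero_apply,
    Finset.smul_sum, smul_smul]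
  rw [Finset.sum_sigma']
  -- Removing `i` then `j` cancels against removing `j` then `i`.
  refine Finset.sum_involution (fun x _ => ⟨x.2, x.1⟩) ?_ ?_ ?_ ?_
  · rintro ⟨i, j⟩ h
    simp only [Finset.mem_sigma, Finset.mem_erase] at h
    rw [koszulSign_mul_erase h.1 h.2.2 (Ne.symm h.2.1), Finset.erase_right_comm,
      mul_left_comm, neg_smul, neg_add_cancel]
  · rintro ⟨i, j⟩ h _ he
    simp only [Finset.mem_sigma, Finset.mem_erase] at h
    simp only [Sigma.mk.injEq] at he
    exact h.2.1 he.1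
  · rintro ⟨i, j⟩ h
    simp only [Finset.mem_sigma, Finset.mem_erase] at h ⊢
    exact ⟨h.2.2, Ne.symm h.2.1, h.1⟩
  · rintro ⟨i, j⟩ h
    rfl

theorem koszulSign_self_insert {m : σ} {G : Finset σ} (hG : ∀ j ∈ G, j < m) :
    koszulSign m (insert m G) = 1 := by
  have : (insert m G).filter (m < ·) = ∅ := by
    refine Finset.filter_eq_empty_iff.2 fun j hj => ?_
    rcases Finset.mem_insert.1 hj with rfl | hj
    · exact lt_irrefl _
    · exact (hG j hj).not_gt
  simp [koszulSign, this]

theorem koszulSign_insert {m : σ} {G : Finset σ} (hG : ∀ j ∈ G, j < m) {i : σ} (hi : i ∈ G) :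
    koszulSign i (insert m G) = -koszulSign i G := by
  have : ((insert m G).filter (i < ·)).card = (G.filter (i < ·)).card + 1 := by
    rw [Finset.filter_insert, if_pos (hG i hi), Finset.card_insert_of_notMem]
    simp only [Finset.mem_filter, not_and]
    exact fun h => absurd (hG m h) (lt_irrefl m)
  rw [koszulSign, koszulSign, this]
  ring

variable (K σ) in
/-- The monomial basis over `K` of the Koszul complex. -/
def koszulBasis : Module.Basis (Σ _ : Finset σ, σ →₀ ℕ) K (Finset σ → MvPolynomial σ K) :=
  Pi.basis fun _ => basisMonomials σ K

theorem koszulBasis_apply (F : Finset σ) (a : σ →₀ ℕ) :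
    koszulBasis K σ ⟨F, a⟩ = Pi.single F (monomial a 1) := by
  simp [koszulBasis]

theorem koszulBasis_repr (f : Finset σ → MvPolynomial σ K) (x : Σ _ : Finset σ, σ →₀ ℕ) :
    (koszulBasis K σ).repr f x = coeff x.2 (f x.1) := by
  simp [koszulBasis, basisMonomials, Pi.basis_repr]
  rfl

theorem koszulD_basis (F : Finset σ) (a : σ →₀ ℕ) :
    koszulD K σ (koszulBasis K σ ⟨F, a⟩) =
      ∑ i ∈ F, koszulSign i F • koszulBasis K σ ⟨F.erase i, a + Finsupp.single i 1⟩ := by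
  simp only [koszulBasis_apply, koszulD_single]
  refine Finset.sum_congr rfl fun i _ => ?_
  rw [X, monomial_mul, one_mul, add_comm]

/-- Since `m` is the top index, its removal has sign `1`, so the matched partner occurs with
coefficient `1`. In all other terms `m` remains on top and flips the sign. -/
theorem koszulD_basis_insert {m : σ} {G : Finset σ} (hG : ∀ j ∈ G, j < m) (c : σ →₀ ℕ) :
    koszulD K σ (koszulBasis K σ ⟨insert m G, c⟩) =
      koszulBasis K σ ⟨G, c + Finsupp.single m 1⟩ -
      ∑ i ∈ G, koszulSign i G •
        koszulBasis K σ ⟨insert m (G.erase i), c + Finsupp.single i 1⟩ := by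
  have hm : m ∉ G := fun h => lt_irrefl _ (hG m h)
  rw [koszulD_basis, Finset.sum_insert hm, koszulSign_self_insert hG, one_smul,
    Finset.erase_insert hm, sub_eq_add_neg, ← Finset.sum_neg_distrib]
  congr 1
  refine Finset.sum_congr rfl fun i hi => ?_
  rw [koszulSign_insert hG hi, neg_smul, Finset.erase_insert_of_ne (hG i hi).ne']

/-! ### Strongly stable sets, the matching and its contracting homotopy -/

/-- All variables occurring in the monomial with exponent `c` have index at most `m`. -/
def BoundedBy (m : σ) (c : σ →₀ ℕ) : Prop := ∀ j, c j ≠ 0 → j ≤ m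

theorem BoundedBy.add_single {m i : σ} {c : σ →₀ ℕ} (hc : BoundedBy m c) (hi : i ≤ m) :
    BoundedBy m (c + Finsupp.single i 1) := by
  intro j hj
  by_cases hij : i = j
  · exact hij ▸ hi
  · exact hc j (by simpa [Finsupp.single_apply, hij] using hj)

/-- In such a factorization `m` is the last variable of the product, so it is determined. This makes
matched partners unique. -/
theorem BoundedBy.eq_of_add_single_eq {m m' : σ} {c c' : σ →₀ ℕ} (hc : BoundedBy m c)
    (hc' : BoundedBy m' c') (h : c + Finsupp.single m 1 = c' + Finsupp.single m' 1) :
    m = m' ∧ c = c' := by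
  have hm : m = m' := by
    refine le_antisymm (hc'.add_single le_rfl m ?_) (hc.add_single le_rfl m' ?_)
    · rw [← h]; simp
    · rw [h]; simp
  subst hm
  exact ⟨rfl, add_right_cancel h⟩

theorem exists_eq_add_single {a : σ →₀ ℕ} (ha : a ≠ 0) :
    ∃ m c, BoundedBy m c ∧ a = c + Finsupp.single m 1 := by
  have hne : a.support.Nonempty := Finsupp.support_nonempty_iff.2 ha
  have hmem : a (a.support.max' hne) ≠ 0 :=
    Finsupp.mem_support_iff.1 (Finset.max'_mem _ hne)
  have hle : Finsupp.single (a.support.max' hne) 1 ≤ a := by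
    rw [Finsupp.single_le_iff]; omega
  refine ⟨a.support.max' hne, a - Finsupp.single (a.support.max' hne) 1, fun j hj => ?_,
    (tsub_add_cancel_of_le hle).symm⟩
  refine Finset.le_max' _ _ (Finsupp.mem_support_iff.2 fun h0 => hj ?_)
  simp [h0]

/-- A set of exponent vectors that spans a strongly stable ideal. -/
structure IsStableSet (S : Set (σ →₀ ℕ)) : Prop where
  add_single : ∀ a i, a ∈ S → a + Finsupp.single i 1 ∈ S
  exchange : ∀ c i m, i ≤ m → c + Finsupp.single m 1 ∈ S → c + Finsupp.single i 1 ∈ S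

/-- Dividing `a * x_i` by its last variable `x_m` gives either `a` itself or `a` with one `x_m`
exchanged for `x_i`, where `i ≤ m`; stability keeps both in `S`. -/
theorem IsStableSet.mem_of_add_single_eq {S : Set (σ →₀ ℕ)} (hS : IsStableSet S)
    {a c : σ →₀ ℕ} {i m : σ} (hm : BoundedBy m c) (ha : a ∈ S)
    (h : a + Finsupp.single i 1 = c + Finsupp.single m 1) : c ∈ S := by
  by_cases him : i = m
  · subst him
    rwa [← add_right_cancel h]
  · have hci : c i ≠ 0 := by
      have := DFunLike.congr_fun h i
      simp [Ne.symm him] at this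
      omega
    have hle : Finsupp.single i 1 ≤ c := by
      rw [Finsupp.single_le_iff]; omega
    obtain ⟨e, rfl⟩ := exists_add_of_le hle
    have hae : a = e + Finsupp.single m 1 := by
      refine add_right_cancel (b := Finsupp.single i 1) ?_
      rw [h]; abel
    rw [add_comm]
    exact hS.exchange e i m (hm i hci) (hae ▸ ha)

/-- The basis elements of the Koszul complex of the ideal spanned by `S` that are matched. -/
inductive IsMatched (S : Set (σ →₀ ℕ)) : (Σ _ : Finset σ, σ →₀ ℕ) → Prop
  | down (m : σ) (G : Finset σ) (c : σ →₀ ℕ) (hG : ∀ j ∈ G, j < m) (hm : BoundedBy m c)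
      (hc : c ∈ S) : IsMatched S ⟨insert m G, c⟩
  | up (m : σ) (G : Finset σ) (c : σ →₀ ℕ) (hG : ∀ j ∈ G, j < m) (hm : BoundedBy m c)
      (hc : c ∈ S) : IsMatched S ⟨G, c + Finsupp.single m 1⟩

open Classical in
variable (K) in
/-- The contracting homotopy on the matched part of the Koszul complex. -/
def koszulH (S : Set (σ →₀ ℕ)) :
    (Finset σ → MvPolynomial σ K) →ₗ[K] (Finset σ → MvPolynomial σ K) :=
  (koszulBasis K σ).constr K fun x =>
    if H : ∃ p : σ × (σ →₀ ℕ), BoundedBy p.1 p.2 ∧ (∀ j ∈ x.1, j < p.1) ∧ p.2 ∈ S ∧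
        x.2 = p.2 + Finsupp.single p.1 1 then
      koszulBasis K σ ⟨insert H.choose.1 x.1, H.choose.2⟩ else 0

theorem koszulH_up {S : Set (σ →₀ ℕ)} {m : σ} {G : Finset σ} {c : σ →₀ ℕ}
    (hG : ∀ j ∈ G, j < m) (hm : BoundedBy m c) (hc : c ∈ S) :
    koszulH K S (koszulBasis K σ ⟨G, c + Finsupp.single m 1⟩) =
      koszulBasis K σ ⟨insert m G, c⟩ := by
  have H : ∃ p : σ × (σ →₀ ℕ), BoundedBy p.1 p.2 ∧ (∀ j ∈ G, j < p.1) ∧ p.2 ∈ S ∧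
      c + Finsupp.single m 1 = p.2 + Finsupp.single p.1 1 := ⟨(m, c), hm, hG, hc, rfl⟩
  rw [koszulH, Module.Basis.constr_basis, dif_pos H]
  obtain ⟨h1, h2⟩ := hm.eq_of_add_single_eq H.choose_spec.1 H.choose_spec.2.2.2
  rw [← h1, ← h2]

/-- A nonzero value would need the last variable of `c` to exceed all of `F`, yet it is at most `m ∈
F`. -/
theorem koszulH_down (S : Set (σ →₀ ℕ)) {m : σ} {F : Finset σ} {c : σ →₀ ℕ}
    (hF : m ∈ F) (hm : BoundedBy m c) : koszulH K S (koszulBasis K σ ⟨F, c⟩) = 0 := by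
  rw [koszulH, Module.Basis.constr_basis, dif_neg]
  rintro ⟨⟨m', c'⟩, -, h2, -, h4⟩
  dsimp only at h2 h4
  refine (h2 m hF).not_ge (hm m' ?_)
  simp [h4]

/-- For an upper element `(G ∪ {m}, c)`, `koszulH` kills it and every boundary term except its
partner, which is sent back to it. For a lower element `(G, c + e_m)`, all boundary terms are again
lower elements with the same `m`, and their images cancel the surplus terms in the boundary of the
partner. -/
theorem koszul_homotopy_basis {S : Set (σ →₀ ℕ)} (hS : IsStableSet S)
    {x : Σ _ : Finset σ, σ →₀ ℕ} (hx : IsMatched S x) :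
    koszulD K σ (koszulH K S (koszulBasis K σ x)) +
      koszulH K S (koszulD K σ (koszulBasis K σ x)) = koszulBasis K σ x := by
  obtain ⟨m, G, c, hG, hm, hc⟩ | ⟨m, G, c, hG, hm, hc⟩ := hx
  · rw [koszulH_down S (Finset.mem_insert_self m G) hm, map_zero, zero_add,
      koszulD_basis_insert hG, map_sub, koszulH_up hG hm hc, map_sum, Finset.sum_eq_zero, sub_zero]
    intro i hi
    rw [map_zsmul, koszulH_down S (Finset.mem_insert_self m _) (hm.add_single (hG i hi).le),
      smul_zero]
  · rw [koszulH_up hG hm hc, koszulD_basis_insert hG, koszulD_basis, map_sum, sub_add,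
      sub_eq_self, sub_eq_zero]
    refine Finset.sum_congr rfl fun i hi => ?_
    rw [map_zsmul, add_right_comm, koszulH_up (fun j hj => hG j (Finset.mem_of_mem_erase hj))
      (hm.add_single (hG i hi).le) (hS.add_single _ _ hc)]

theorem koszul_homotopy {S : Set (σ →₀ ℕ)} (hS : IsStableSet S)
    {f : Finset σ → MvPolynomial σ K}
    (hf : f ∈ Submodule.span K (koszulBasis K σ '' {x | IsMatched S x})) :
    koszulD K σ (koszulH K S f) + koszulH K S (koszulD K σ f) = f := by
  induction hf using Submodule.span_induction with
  | mem x hx =>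
    obtain ⟨y, hy, rfl⟩ := hx
    exact koszul_homotopy_basis hS hy
  | zero => simp
  | add x y _ _ hx hy =>
    conv_rhs => rw [← hx, ← hy]
    simp only [map_add]
    abel
  | smul c x _ hx =>
    have h : ∀ g, koszulD K σ (c • g) = c • koszulD K σ g := fun g =>
      LinearMap.map_smul_of_tower _ _ _
    rw [map_smul, h, h, map_smul, ← smul_add, hx]

/-- Compare the last variable `m` of the new monomial with the remaining indices. If `m` exceeds
them all, dividing by `x_m` stays in `S` and gives the partner; otherwise the largest remaining
index bounds the monomial and can be removed. -/
theorem isMatched_erase {S : Set (σ →₀ ℕ)} (hS : IsStableSet S) {F : Finset σ} {a : σ →₀ ℕ}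
    (ha : a ∈ S) {i : σ} :
    IsMatched S ⟨F.erase i, a + Finsupp.single i 1⟩ := by
  obtain ⟨m, c, hm, h⟩ := exists_eq_add_single (a := a + Finsupp.single i 1) (by
    intro h
    simpa using DFunLike.congr_fun h i)
  have hb : BoundedBy m (a + Finsupp.single i 1) := h ▸ hm.add_single le_rfl
  by_cases hF : ∀ j ∈ F.erase i, j < m
  · rw [h]
    refine .up m _ c hF hm ?_
    exact hS.mem_of_add_single_eq hm ha h
  · push Not at hF
    obtain ⟨j, hj, hmj⟩ := hF
    have hne : (F.erase i).Nonempty := ⟨j, hj⟩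
    set t := (F.erase i).max' hne
    have ht : t ∈ F.erase i := Finset.max'_mem _ hne
    have hmt : m ≤ t := hmj.trans (Finset.le_max' _ _ hj)
    have := IsMatched.down (S := S) t ((F.erase i).erase t) (a + Finsupp.single i 1)
      (fun k hk => lt_of_le_of_ne (Finset.le_max' _ _ (Finset.mem_of_mem_erase hk))
        (Finset.ne_of_mem_erase hk)) (fun k hk => (hb k hk).trans hmt) (hS.add_single _ _ ha)
    rwa [Finset.insert_erase ht] at this

variable (K) in
/-- The degree `q` part of the Koszul complex of the ideal spanned by `S`. -/
def koszulPart (S : Set (σ →₀ ℕ)) (q : ℕ) : Submodule K (Finset σ → MvPolynomial σ K) :=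
  Submodule.span K (koszulBasis K σ '' {x | x.2 ∈ S ∧ x.1.card = q})

theorem IsMatched.mem {S : Set (σ →₀ ℕ)} (hS : IsStableSet S)
    {x : Σ _ : Finset σ, σ →₀ ℕ} (hx : IsMatched S x) : x.2 ∈ S := by
  obtain ⟨m, G, c, hG, hm, hc⟩ | ⟨m, G, c, hG, hm, hc⟩ := hx
  · exact hc
  · exact hS.add_single _ _ hc

theorem koszulD_mem_matched {S : Set (σ →₀ ℕ)} (hS : IsStableSet S) {q : ℕ}
    {f : Finset σ → MvPolynomial σ K} (hf : f ∈ koszulPart K S (q + 1)) :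
    koszulD K σ f ∈ Submodule.span K
      (koszulBasis K σ '' {x | IsMatched S x ∧ x.1.card = q}) := by
  induction hf using Submodule.span_induction with
  | mem x hx =>
    obtain ⟨⟨F, a⟩, ⟨ha, hF⟩, rfl⟩ := hx
    rw [koszulD_basis]
    refine Submodule.sum_mem _ fun i hi => zsmul_mem (Submodule.subset_span ?_) _
    refine Set.mem_image_of_mem _ ⟨isMatched_erase hS ha, ?_⟩
    simp only at hF ⊢
    rw [Finset.card_erase_of_mem hi, hF, Nat.add_sub_cancel]
  | zero => simp
  | add x y _ _ hx hy => rw [map_add]; exact add_mem hx hy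
  | smul c x _ hx =>
    rw [LinearMap.map_smul_of_tower]; exact Submodule.smul_mem _ c hx

theorem koszulH_mem {S : Set (σ →₀ ℕ)} {q : ℕ}
    {f : Finset σ → MvPolynomial σ K} (hf : f ∈ koszulPart K S q) :
    koszulH K S f ∈ koszulPart K S (q + 1) := by
  induction hf using Submodule.span_induction with
  | mem x hx =>
    obtain ⟨⟨F, a⟩, ⟨ha, hF⟩, rfl⟩ := hx
    by_cases H : ∃ p : σ × (σ →₀ ℕ), BoundedBy p.1 p.2 ∧ (∀ j ∈ F, j < p.1) ∧ p.2 ∈ S ∧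
        a = p.2 + Finsupp.single p.1 1
    · obtain ⟨⟨m, c⟩, h1, h2, h3, rfl⟩ := H
      rw [koszulH_up h2 h1 h3]
      refine Submodule.subset_span (Set.mem_image_of_mem _ ⟨h3, ?_⟩)
      rw [Finset.card_insert_of_notMem fun h => lt_irrefl _ (h2 _ h)]
      exact congrArg (· + 1) hF
    · rw [koszulH, Module.Basis.constr_basis, dif_neg H]
      exact zero_mem _
  | zero => simp
  | add x y _ _ hx hy => rw [map_add]; exact add_mem hx hy
  | smul c x _ hx => rw [map_smul]; exact Submodule.smul_mem _ c hx

/-- The unmatched basis elements in degree `q`. -/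
def criticalSet (S : Set (σ →₀ ℕ)) (q : ℕ) : Set (Σ _ : Finset σ, σ →₀ ℕ) :=
  {x | x.2 ∈ S ∧ x.1.card = q ∧ ¬ IsMatched S x}

variable (K) in
/-- The coefficients at the unmatched basis elements. -/
def criticalCoeff (S : Set (σ →₀ ℕ)) (q : ℕ) :
    (Finset σ → MvPolynomial σ K) →ₗ[K] (criticalSet S q →₀ K) :=
  Finsupp.lcomapDomain (Subtype.val : criticalSet S q → _) Subtype.val_injective ∘ₗ
    (koszulBasis K σ).repr.toLinearMap

theorem criticalCoeff_apply (S : Set (σ →₀ ℕ)) (q : ℕ) (f : Finset σ → MvPolynomial σ K)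
    (x : criticalSet S q) : criticalCoeff K S q f x = (koszulBasis K σ).repr f x := rfl

theorem criticalCoeff_eq_zero_of_matched {S : Set (σ →₀ ℕ)} {q : ℕ}
    {f : Finset σ → MvPolynomial σ K}
    (hf : f ∈ Submodule.span K (koszulBasis K σ '' {x | IsMatched S x ∧ x.1.card = q})) :
    criticalCoeff K S q f = 0 := by
  ext x
  rw [criticalCoeff_apply, Finsupp.zero_apply]
  by_contra h
  exact x.2.2.2 ((Module.Basis.mem_span_image _).1 hf (Finsupp.mem_support_iff.2 h)).1

theorem criticalCoeff_koszulD {S : Set (σ →₀ ℕ)} (hS : IsStableSet S) {q : ℕ}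
    {f : Finset σ → MvPolynomial σ K} (hf : f ∈ koszulPart K S (q + 1)) :
    criticalCoeff K S q (koszulD K σ f) = 0 :=
  criticalCoeff_eq_zero_of_matched (koszulD_mem_matched hS hf)

theorem mem_matched_of_criticalCoeff_eq_zero {S : Set (σ →₀ ℕ)} {q : ℕ}
    {f : Finset σ → MvPolynomial σ K} (hf : f ∈ koszulPart K S q)
    (h : criticalCoeff K S q f = 0) :
    f ∈ Submodule.span K (koszulBasis K σ '' {x | IsMatched S x}) := by
  rw [Module.Basis.mem_span_image]
  intro x hx
  by_contra hx'
  obtain ⟨h1, h2⟩ := (Module.Basis.mem_span_image _).1 hf hx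
  exact Finsupp.mem_support_iff.1 hx (DFunLike.congr_fun h ⟨x, h1, h2, hx'⟩)

theorem exists_koszulD_eq {S : Set (σ →₀ ℕ)} (hS : IsStableSet S) {q : ℕ}
    {f : Finset σ → MvPolynomial σ K} (hf : f ∈ koszulPart K S q) (hd : koszulD K σ f = 0)
    (h : criticalCoeff K S q f = 0) : ∃ g ∈ koszulPart K S (q + 1), koszulD K σ g = f := by
  refine ⟨koszulH K S f, koszulH_mem hf, ?_⟩
  simpa [hd] using koszul_homotopy hS (mem_matched_of_criticalCoeff_eq_zero hf h)

theorem koszulPart_zero_koszulD {S : Set (σ →₀ ℕ)}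
    {f : Finset σ → MvPolynomial σ K} (hf : f ∈ koszulPart K S 0) : koszulD K σ f = 0 := by
  induction hf using Submodule.span_induction with
  | mem x hx =>
    obtain ⟨⟨F, a⟩, ⟨ha, hF⟩, rfl⟩ := hx
    obtain rfl := Finset.card_eq_zero.1 hF
    simp [koszulD_basis]
  | zero => simp
  | add x y _ _ hx hy => rw [map_add, hx, hy, add_zero]
  | smul c x _ hx => rw [LinearMap.map_smul_of_tower, hx, smul_zero]

/-- The boundary of an unmatched basis element lies in the matched span, where the homotopy applies.
Subtracting the homotopy of the boundary makes the element a cycle, and changes only matched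
coefficients. -/
theorem exists_cycle_single {S : Set (σ →₀ ℕ)} (hS : IsStableSet S) {q : ℕ}
    (x : criticalSet S q) : ∃ f ∈ koszulPart K S q, koszulD K σ f = 0 ∧
      criticalCoeff K S q f = Finsupp.single x 1 := by
  have hx : koszulBasis K σ x.1 ∈ koszulPart K S q :=
    Submodule.subset_span (Set.mem_image_of_mem _ ⟨x.2.1, x.2.2.1⟩)
  have hcoeff : criticalCoeff K S q (koszulBasis K σ x.1) = Finsupp.single x 1 := by
    ext y
    rw [criticalCoeff_apply, Module.Basis.repr_self, Finsupp.single_apply, Finsupp.single_apply]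
    simp [Subtype.ext_iff]
  rcases Nat.eq_zero_or_pos q with rfl | hq
  · exact ⟨_, hx, koszulPart_zero_koszulD hx, hcoeff⟩
  · obtain ⟨q, rfl⟩ := Nat.exists_eq_succ_of_ne_zero hq.ne'
    have hd := koszulD_mem_matched hS hx
    have hmem : koszulH K S (koszulD K σ (koszulBasis K σ x.1)) ∈ koszulPart K S (q + 1) := by
      refine koszulH_mem (Submodule.span_mono (Set.image_mono ?_) hd)
      exact fun y hy => ⟨hy.1.mem hS, hy.2⟩
    refine ⟨koszulBasis K σ x.1 - koszulH K S (koszulD K σ (koszulBasis K σ x.1)),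
      sub_mem hx hmem, ?_, ?_⟩
    · have h := koszul_homotopy hS
        (Submodule.span_mono (Set.image_mono fun y hy => hy.1) hd)
      rw [koszulD_koszulD, map_zero, add_zero] at h
      rw [map_sub, h, sub_self]
    · rw [map_sub, hcoeff, sub_eq_self]
      ext y
      rw [criticalCoeff_apply, Finsupp.zero_apply]
      by_contra hy
      refine y.2.2.2 ?_
      have hD := (Module.Basis.mem_span_image (b := koszulBasis K σ)
        (s := {x | IsMatched S x})).1 ?_ (Finsupp.mem_support_iff.2 hy)
      · exact hD
      clear hy y
      generalize koszulD K σ (koszulBasis K σ x.1) = g at hd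
      induction hd using Submodule.span_induction with
      | mem z hz =>
        obtain ⟨z, ⟨hz, -⟩, rfl⟩ := hz
        obtain ⟨m, G, c, hG, hm, hc⟩ | ⟨m, G, c, hG, hm, hc⟩ := hz
        · rw [koszulH_down S (Finset.mem_insert_self m G) hm]
          exact zero_mem _
        · rw [koszulH_up hG hm hc]
          exact Submodule.subset_span (Set.mem_image_of_mem _ (.down m G c hG hm hc))
      | zero => simp
      | add x y _ _ hx hy => rw [map_add]; exact add_mem hx hy
      | smul c x _ hx => rw [map_smul]; exact Submodule.smul_mem _ c hx

theorem exists_cycle {S : Set (σ →₀ ℕ)} (hS : IsStableSet S) {q : ℕ}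
    (v : criticalSet S q →₀ K) : ∃ f ∈ koszulPart K S q, koszulD K σ f = 0 ∧
      criticalCoeff K S q f = v := by
  induction v using Finsupp.induction_linear with
  | zero => exact ⟨0, by simp, by simp, by simp⟩
  | add v w hv hw =>
    obtain ⟨f, hf, hf', rfl⟩ := hv
    obtain ⟨g, hg, hg', rfl⟩ := hw
    exact ⟨f + g, add_mem hf hg, by simp [hf', hg'], by simp⟩
  | single x c =>
    obtain ⟨f, hf, hf', h⟩ := exists_cycle_single (K := K) hS x
    refine ⟨c • f, Submodule.smul_mem _ c hf, ?_, ?_⟩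
    · rw [LinearMap.map_smul_of_tower, hf', smul_zero]
    · rw [map_smul, h, Finsupp.smul_single_one]

end Koszul

/-! ### Criteria for being matched -/

section Matched

variable {σ : Type*} [Fintype σ] [LinearOrder σ]

theorem isMatched_add_single_iff {S : Set (σ →₀ ℕ)} {m : σ} {c : σ →₀ ℕ} (hm : BoundedBy m c)
    (ha : c + Finsupp.single m 1 ∈ S) (F : Finset σ) :
    IsMatched S ⟨F, c + Finsupp.single m 1⟩ ↔ (∃ j ∈ F, m ≤ j) ∨ c ∈ S := by
  constructor
  · intro h
    generalize hx : (⟨F, c + Finsupp.single m 1⟩ : Σ _ : Finset σ, σ →₀ ℕ) = x at h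
    obtain ⟨m', G, c', hG, hm', hc⟩ | ⟨m', G, c', hG, hm', hc⟩ := h
    · simp only [Sigma.mk.injEq, heq_eq_eq] at hx
      refine .inl ⟨m', hx.1 ▸ Finset.mem_insert_self _ _, hm' m ?_⟩
      simp [← hx.2]
    · simp only [Sigma.mk.injEq, heq_eq_eq] at hx
      obtain ⟨-, rfl⟩ := hm.eq_of_add_single_eq hm' hx.2
      exact .inr hc
  · intro h
    by_cases hF : ∃ j ∈ F, m ≤ j
    · obtain ⟨j, hj, hmj⟩ := hF
      have hne : F.Nonempty := ⟨j, hj⟩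
      have := IsMatched.down (S := S) (F.max' hne) (F.erase (F.max' hne))
        (c + Finsupp.single m 1) (fun k hk => lt_of_le_of_ne
          (Finset.le_max' _ _ (Finset.mem_of_mem_erase hk)) (Finset.ne_of_mem_erase hk))
        (fun k hk => (hm.add_single le_rfl k hk).trans (hmj.trans (Finset.le_max' _ _ hj))) ha
      rwa [Finset.insert_erase (Finset.max'_mem _ hne)] at this
    · have hc := h.resolve_left hF
      push Not at hF
      exact .up m F c hF hm hc

/-- The monomial `1` has no last variable to move into `F`, so only the largest element of `F` can
provide a partner. -/
theorem isMatched_zero_iff {S : Set (σ →₀ ℕ)} (ha : 0 ∈ S) (F : Finset σ) :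
    IsMatched S ⟨F, 0⟩ ↔ F.Nonempty := by
  constructor
  · intro h
    generalize hx : (⟨F, 0⟩ : Σ _ : Finset σ, σ →₀ ℕ) = x at h
    obtain ⟨m', G, c', hG, hm', hc⟩ | ⟨m', G, c', hG, hm', hc⟩ := h
    · simp only [Sigma.mk.injEq, heq_eq_eq] at hx
      exact hx.1 ▸ Finset.insert_nonempty _ _
    · simp only [Sigma.mk.injEq, heq_eq_eq] at hx
      simpa using DFunLike.congr_fun hx.2 m'
  · intro hne
    have := IsMatched.down (S := S) (F.max' hne) (F.erase (F.max' hne)) 0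
      (fun k hk => lt_of_le_of_ne
        (Finset.le_max' _ _ (Finset.mem_of_mem_erase hk)) (Finset.ne_of_mem_erase hk))
      (fun k hk => absurd rfl hk) ha
    rwa [Finset.insert_erase (Finset.max'_mem _ hne)] at this

theorem isStableSet_univ : IsStableSet (Set.univ : Set (σ →₀ ℕ)) :=
  ⟨fun _ _ _ => trivial, fun _ _ _ _ _ => trivial⟩

theorem eq_zero_of_mem_criticalSet_univ {q : ℕ} {x : Σ _ : Finset σ, σ →₀ ℕ}
    (hx : x ∈ criticalSet Set.univ q) : x.1 = ∅ ∧ x.2 = 0 := by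
  obtain ⟨F, a⟩ := x
  obtain ⟨-, -, h⟩ := hx
  by_cases ha : a = 0
  · subst ha
    rw [isMatched_zero_iff (Set.mem_univ _), Finset.not_nonempty_iff_eq_empty] at h
    exact ⟨h, rfl⟩
  · obtain ⟨m, c, hm, rfl⟩ := exists_eq_add_single ha
    exact absurd ((isMatched_add_single_iff hm (Set.mem_univ _) F).2 (.inr (Set.mem_univ _))) h

end Matched

/-! ### The Koszul complex resolves the residue field -/

section Resolution

universe u

variable {K : Type u} {σ : Type} [Field K] [Fintype σ] [LinearOrder σ]

theorem mem_koszulPart {S : Set (σ →₀ ℕ)} {q : ℕ} {f : Finset σ → MvPolynomial σ K} :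
    f ∈ koszulPart K S q ↔ ∀ F a, coeff a (f F) ≠ 0 → a ∈ S ∧ F.card = q := by
  rw [koszulPart, Module.Basis.mem_span_image]
  refine ⟨fun h F a ha => ?_, fun h x hx => ?_⟩
  · refine h (a := ⟨F, a⟩) (Finsupp.mem_support_iff.2 ?_)
    rwa [koszulBasis_repr]
  · refine h x.1 x.2 ?_
    rw [← koszulBasis_repr]
    exact Finsupp.mem_support_iff.1 hx

variable (K σ) in
/-- The degree `q` term of the Koszul complex of `MvPolynomial σ K`. -/
abbrev KoszulTerm (q : ℕ) : Type u := {F : Finset σ // F.card = q} → MvPolynomial σ K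

variable (K σ) in
/-- Extension by zero to all subsets. -/
def koszulExt (q : ℕ) :
    KoszulTerm K σ q →ₗ[MvPolynomial σ K] (Finset σ → MvPolynomial σ K) :=
  Function.ExtendByZero.linearMap _ Subtype.val

variable (K σ) in
/-- Restriction to the subsets with `q` elements. -/
def koszulRes (q : ℕ) :
    (Finset σ → MvPolynomial σ K) →ₗ[MvPolynomial σ K] KoszulTerm K σ q :=
  LinearMap.funLeft _ _ Subtype.val

theorem koszulExt_apply {q : ℕ} (f : KoszulTerm K σ q) (F : {F : Finset σ // F.card = q}) :
    koszulExt K σ q f F = f F :=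
  Subtype.val_injective.extend_apply _ _ _

theorem koszulExt_apply_of_ne {q : ℕ} (f : KoszulTerm K σ q) {F : Finset σ} (hF : F.card ≠ q) :
    koszulExt K σ q f F = 0 :=
  Function.extend_apply' _ _ _ (by rintro ⟨G, rfl⟩; exact hF G.2)

theorem koszulRes_koszulExt {q : ℕ} (f : KoszulTerm K σ q) :
    koszulRes K σ q (koszulExt K σ q f) = f :=
  funext fun F => koszulExt_apply f F

theorem koszulExt_koszulRes {S : Set (σ →₀ ℕ)} {q : ℕ} {f : Finset σ → MvPolynomial σ K}
    (hf : f ∈ koszulPart K S q) : koszulExt K σ q (koszulRes K σ q f) = f := by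
  funext F
  by_cases hF : F.card = q
  · exact koszulExt_apply _ ⟨F, hF⟩
  · rw [koszulExt_apply_of_ne _ hF]
    ext a
    by_contra h
    exact hF ((mem_koszulPart.1 hf F a (by simpa [eq_comm] using h)).2)

theorem koszulExt_mem {q : ℕ} (f : KoszulTerm K σ q) :
    koszulExt K σ q f ∈ koszulPart K Set.univ q := by
  rw [mem_koszulPart]
  refine fun F a ha => ⟨trivial, ?_⟩
  by_contra hF
  simp [koszulExt_apply_of_ne f hF] at ha

theorem koszulD_mem {S : Set (σ →₀ ℕ)} (hS : IsStableSet S) {q : ℕ}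
    {f : Finset σ → MvPolynomial σ K} (hf : f ∈ koszulPart K S (q + 1)) :
    koszulD K σ f ∈ koszulPart K S q :=
  Submodule.span_mono (Set.image_mono (by
    rintro y ⟨h1, h2⟩; exact ⟨h1.mem hS, h2⟩)) (koszulD_mem_matched hS hf)

variable (K σ) in
/-- The differential between two terms of the Koszul complex (zero unless `i = j + 1`). -/
def koszulDiff (i j : ℕ) : KoszulTerm K σ i →ₗ[MvPolynomial σ K] KoszulTerm K σ j :=
  koszulRes K σ j ∘ₗ koszulD K σ ∘ₗ koszulExt K σ i

theorem koszulExt_koszulDiff {j : ℕ} (f : KoszulTerm K σ (j + 1)) :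
    koszulExt K σ j (koszulDiff K σ (j + 1) j f) = koszulD K σ (koszulExt K σ (j + 1) f) :=
  koszulExt_koszulRes (koszulD_mem isStableSet_univ (koszulExt_mem f))

theorem koszulDiff_of_ne {i j : ℕ} (h : j + 1 ≠ i) : koszulDiff K σ i j = 0 := by
  refine LinearMap.ext fun f => ?_
  rw [koszulDiff, LinearMap.comp_apply, LinearMap.comp_apply, LinearMap.zero_apply]
  rcases i with - | i
  · rw [koszulPart_zero_koszulD (koszulExt_mem f), map_zero]
  · funext F
    ext a
    by_contra hne
    have := (mem_koszulPart.1 (koszulD_mem isStableSet_univ (koszulExt_mem f)) F.1 a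
      (fun h0 => hne (h0.trans (by simp)))).2
    rw [F.2] at this
    exact h (congrArg (· + 1) this)

theorem koszulDiff_koszulDiff (i j k : ℕ) :
    koszulDiff K σ j k ∘ₗ koszulDiff K σ i j = 0 := by
  by_cases h : j + 1 = i
  · subst h
    refine LinearMap.ext fun f => ?_
    rw [LinearMap.comp_apply, LinearMap.zero_apply, koszulDiff, LinearMap.comp_apply,
      LinearMap.comp_apply, koszulExt_koszulDiff, koszulD_koszulD, map_zero]
  · rw [koszulDiff_of_ne h, LinearMap.comp_zero]

variable (K σ) in
/-- The Koszul complex of the variables. -/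
def koszulComplex : ChainComplex (ModuleCat.{u} (MvPolynomial σ K)) ℕ where
  X q := ModuleCat.of _ (KoszulTerm K σ q)
  d i j := ModuleCat.ofHom (koszulDiff K σ i j)
  shape i j h := by
    rw [koszulDiff_of_ne (by simpa using h)]; rfl
  d_comp_d' i j k _ _ := by
    rw [← ModuleCat.ofHom_comp, koszulDiff_koszulDiff]; rfl

theorem koszulDiff_exact (q : ℕ) (f : KoszulTerm K σ (q + 1))
    (hf : koszulDiff K σ (q + 1) q f = 0) : ∃ g, koszulDiff K σ (q + 2) (q + 1) g = f := by
  obtain ⟨g, hg, hgf⟩ := exists_koszulD_eq isStableSet_univ (koszulExt_mem f)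
    -- For the full polynomial ring the only unmatched element is `(∅, 0)`, in degree `0`, so there
    -- is no condition in positive degree.
    (by rw [← koszulExt_koszulDiff, hf, map_zero]) (by
      ext x
      have h1 := x.2.2.1
      rw [(eq_zero_of_mem_criticalSet_univ x.2).1] at h1
      simp at h1)
  refine ⟨koszulRes K σ (q + 2) g, ?_⟩
  rw [koszulDiff, LinearMap.comp_apply, LinearMap.comp_apply, koszulExt_koszulRes hg, hgf,
    koszulRes_koszulExt]

variable (K σ) in
/-- The ideal generated by the variables. -/
abbrev varIdeal : Ideal (MvPolynomial σ K) := Ideal.span (Set.range X)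

theorem koszulD_apply_empty_mem (f : Finset σ → MvPolynomial σ K) :
    koszulD K σ f ∅ ∈ varIdeal K σ := by
  rw [koszulD, LinearMap.sum_apply, Finset.sum_apply]
  refine Ideal.sum_mem _ fun F _ => ?_
  rw [LinearMap.sum_apply, Finset.sum_apply]
  refine Ideal.sum_mem _ fun i _ => ?_
  rw [LinearMap.smul_apply, Pi.smul_apply]
  refine zsmul_mem ?_ _
  simp only [LinearMap.comp_apply, LinearMap.proj_apply, LinearMap.lsmul_apply,
    LinearMap.single_apply, smul_eq_mul, Pi.single_apply]
  split_ifs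
  · exact Ideal.mul_mem_right _ _ (Ideal.subset_span ⟨i, rfl⟩)
  · exact zero_mem _

theorem varIdeal_le : varIdeal K σ ≤ RingHom.ker (constantCoeff (R := K) (σ := σ)) := by
  rw [Ideal.span_le]
  rintro _ ⟨i, rfl⟩
  simp

variable (K σ) in
/-- The augmentation of the Koszul complex. -/
def koszulAug : KoszulTerm K σ 0 →ₗ[MvPolynomial σ K] (MvPolynomial σ K ⧸ varIdeal K σ) :=
  (varIdeal K σ).mkQ ∘ₗ LinearMap.proj ⟨∅, rfl⟩

theorem koszulAug_koszulDiff (f : KoszulTerm K σ 1) :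
    koszulAug K σ (koszulDiff K σ 1 0 f) = 0 := by
  rw [koszulAug, LinearMap.comp_apply, Submodule.mkQ_apply, Submodule.Quotient.mk_eq_zero]
  exact koszulD_apply_empty_mem _

theorem koszulAug_surjective : Function.Surjective (koszulAug K σ) := by
  intro y
  obtain ⟨p, rfl⟩ := Submodule.mkQ_surjective _ y
  exact ⟨fun _ => p, rfl⟩

theorem koszulAug_exact (f : KoszulTerm K σ 0) (hf : koszulAug K σ f = 0) :
    ∃ g, koszulDiff K σ 1 0 g = f := by
  rw [koszulAug, LinearMap.comp_apply, Submodule.mkQ_apply, Submodule.Quotient.mk_eq_zero] at hf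
  obtain ⟨g, hg, hgf⟩ := exists_koszulD_eq isStableSet_univ (koszulExt_mem f)
    (koszulPart_zero_koszulD (koszulExt_mem f)) (by
      -- The only unmatched coefficient is the constant term, which vanishes on the ideal of the
      -- variables.
      ext x
      obtain ⟨h1, h2⟩ := eq_zero_of_mem_criticalSet_univ x.2
      rw [criticalCoeff_apply, koszulBasis_repr, h1, h2]
      exact (congrArg (coeff 0) (koszulExt_apply f ⟨∅, rfl⟩)).trans (varIdeal_le hf))
  refine ⟨koszulRes K σ 1 g, ?_⟩
  rw [koszulDiff, LinearMap.comp_apply, LinearMap.comp_apply, koszulExt_koszulRes hg, hgf,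
    koszulRes_koszulExt]

variable (K σ) in
/-- The Koszul complex as a projective resolution of the residue field. -/
def koszulResolution :
    ProjectiveResolution (ModuleCat.of (MvPolynomial σ K) (MvPolynomial σ K ⧸ varIdeal K σ)) where
  complex := koszulComplex K σ
  projective q := by
    have : Module.Projective (MvPolynomial σ K) (KoszulTerm K σ q) := inferInstance
    exact (IsProjective.iff_projective (R := MvPolynomial σ K) (KoszulTerm K σ q)).1 this
  π := (ChainComplex.toSingle₀Equiv _ _).symm ⟨ModuleCat.ofHom (koszulAug K σ), by
    refine ModuleCat.hom_ext (LinearMap.ext fun f => ?_)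
    exact koszulAug_koszulDiff f⟩
  quasiIso := ⟨fun n => by
    cases n with
    | zero =>
      rw [ChainComplex.quasiIsoAt₀_iff, ShortComplex.quasiIso_iff_of_zeros' _ _ rfl rfl]
      · constructor
        · rw [ShortComplex.moduleCat_exact_iff]
          intro f hf
          obtain ⟨g, hg⟩ := koszulAug_exact (K := K) (σ := σ) f hf
          exact ⟨g, hg⟩
        · rw [ModuleCat.epi_iff_surjective]
          exact koszulAug_surjective
      · exact (koszulComplex K σ).shape _ _ (by simp)
    | succ n =>
      rw [quasiIsoAt_iff_exactAt' (hL := ChainComplex.exactAt_succ_single_obj ..),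
        HomologicalComplex.exactAt_iff' _ (n + 2) (n + 1) n (by simp) (by simp),
        ShortComplex.moduleCat_exact_iff]
      intro f hf
      exact koszulDiff_exact n f hf⟩

end Resolution

/-! ### Dimension of homology from a map on cycles -/

section Homology

universe u v w

variable {K : Type w} {R : Type u} [Field K] [CommRing R] [Algebra K R]

/-- Homology and `W` are both quotients of the `K`-space of cycles, with the same kernel. The map
`ρ` is only additive, with a separate scalar rule, because `S.X₂` carries a `K`-action only through
`algebraMap`. -/
theorem finrank_homology (S : ShortComplex (ModuleCat.{v} R)) {W : Type*} [AddCommGroup W]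
    [Module K W] (ρ : S.X₂ →+ W) (hρ : ∀ (c : K) x, ρ (algebraMap K R c • x) = c • ρ x)
    (h1 : ∀ x, S.g x = 0 → (ρ x = 0 ↔ ∃ y, S.f y = x)) (h2 : ∀ w, ∃ x, S.g x = 0 ∧ ρ x = w) :
    Module.finrank K ((ModuleCat.restrictScalars (algebraMap K R)).obj S.homology) =
      Module.finrank K W := by
  let D := S.moduleCatLeftHomologyData
  let e : (ModuleCat.restrictScalars (algebraMap K R)).obj S.homology ≃ₗ[K]
      (ModuleCat.restrictScalars (algebraMap K R)).obj D.H :=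
    ((ModuleCat.restrictScalars (algebraMap K R)).mapIso D.homologyIso).toLinearEquiv
  let A : (ModuleCat.restrictScalars (algebraMap K R)).obj D.K →ₗ[K]
      (ModuleCat.restrictScalars (algebraMap K R)).obj D.H :=
    ((ModuleCat.restrictScalars (algebraMap K R)).map D.π).hom
  let B : (ModuleCat.restrictScalars (algebraMap K R)).obj D.K →ₗ[K] W :=
    { toFun := fun x => ρ (LinearMap.ker S.g.hom |>.subtype x)
      map_add' := fun x y => by rw [← map_add]; rfl
      map_smul' := fun c x => hρ c _ }
  have hA : Function.Surjective A :=
    (ModuleCat.epi_iff_surjective D.π).1 inferInstance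
  have hB : Function.Surjective B := by
    intro w
    obtain ⟨x, hx, rfl⟩ := h2 w
    exact ⟨(⟨x, hx⟩ : LinearMap.ker S.g.hom), rfl⟩
  have key : ∀ x : LinearMap.ker S.g.hom,
      (Submodule.Quotient.mk x : _ ⧸ LinearMap.range S.moduleCatToCycles) = 0 ↔ ρ x.1 = 0 := by
    intro x
    rw [h1 x.1 x.2, Submodule.Quotient.mk_eq_zero, LinearMap.mem_range]
    exact exists_congr fun y => Subtype.ext_iff
  have hker : LinearMap.ker A = LinearMap.ker B := by
    ext x
    exact key x
  exact (e ≪≫ₗ (A.quotKerEquivOfSurjective hA).symm ≪≫ₗ Submodule.quotEquivOfEq _ _ hker ≪≫ₗ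
    B.quotKerEquivOfSurjective hB).finrank_eq

end Homology

/-! ### Tor of a stable ideal with the residue field -/

section Tor

universe u

open TensorProduct

variable {K : Type u} {σ : Type} [Field K] [Fintype σ] [LinearOrder σ]

/-- The tensor product of an ideal with a term of the Koszul complex, realized by the functions
with values in the ideal. -/
def koszulTensor (I : Ideal (MvPolynomial σ K)) (q : ℕ) :
    I ⊗[MvPolynomial σ K] KoszulTerm K σ q →ₗ[MvPolynomial σ K] (Finset σ → MvPolynomial σ K) :=
  TensorProduct.lift
    (((LinearMap.lsmul (MvPolynomial σ K) (Finset σ → MvPolynomial σ K)).domRestrict I).compl₂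
      (koszulExt K σ q))

theorem koszulTensor_tmul (I : Ideal (MvPolynomial σ K)) (q : ℕ) (p : I) (f : KoszulTerm K σ q) :
    koszulTensor I q (p ⊗ₜ f) = (p : MvPolynomial σ K) • koszulExt K σ q f := rfl

theorem koszulTensor_apply (I : Ideal (MvPolynomial σ K)) (q : ℕ)
    (z : I ⊗[MvPolynomial σ K] KoszulTerm K σ q) :
    koszulTensor I q z = koszulExt K σ q fun F =>
      (piScalarRight (MvPolynomial σ K) (MvPolynomial σ K) I _ z F : MvPolynomial σ K) := by
  induction z with
  | zero =>
    rw [map_zero, map_zero]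
    exact (map_zero (koszulExt K σ q)).symm
  | add x y hx hy =>
    rw [map_add, map_add, hx, hy, ← map_add]
    rfl
  | tmul p f =>
    rw [koszulTensor_tmul, piScalarRight_apply, piScalarRightHom_tmul, ← map_smul]
    refine congrArg _ (funext fun F => ?_)
    exact mul_comm _ _

/-- The Koszul terms are free, so the tensor product is a power of `I`, sitting inside the same
power of the ring. -/
theorem koszulTensor_injective (I : Ideal (MvPolynomial σ K)) (q : ℕ) :
    Function.Injective (koszulTensor I q) := by
  intro z w h
  rw [koszulTensor_apply, koszulTensor_apply] at h
  refine (piScalarRight (MvPolynomial σ K) (MvPolynomial σ K) I _).injective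
    (funext fun F => Subtype.ext ?_)
  have h' := congrArg (koszulRes K σ q) h
  rw [koszulRes_koszulExt, koszulRes_koszulExt] at h'
  exact congrFun h' F

theorem koszulD_koszulTensor (I : Ideal (MvPolynomial σ K)) (q : ℕ)
    (z : I ⊗[MvPolynomial σ K] KoszulTerm K σ (q + 1)) :
    koszulD K σ (koszulTensor I (q + 1) z) =
      koszulTensor I q ((koszulDiff K σ (q + 1) q).lTensor I z) := by
  induction z with
  | zero => simp
  | add x y hx hy => simp only [map_add, hx, hy]
  | tmul p f =>
    rw [LinearMap.lTensor_tmul, koszulTensor_tmul, koszulTensor_tmul, map_smul,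
      koszulExt_koszulDiff]

variable {I : Ideal (MvPolynomial σ K)} {S : Set (σ →₀ ℕ)}

theorem koszulTensor_mem (hI : ∀ p, p ∈ I ↔ ∀ a, coeff a p ≠ 0 → a ∈ S) (q : ℕ)
    (z : I ⊗[MvPolynomial σ K] KoszulTerm K σ q) : koszulTensor I q z ∈ koszulPart K S q := by
  rw [koszulTensor_apply, mem_koszulPart]
  intro F a ha
  by_cases hF : F.card = q
  · have h := koszulExt_apply (fun F =>
      (piScalarRight (MvPolynomial σ K) (MvPolynomial σ K) I _ z F : MvPolynomial σ K)) ⟨F, hF⟩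
    rw [h] at ha
    exact ⟨(hI _).1 (Subtype.property _) a ha, hF⟩
  · rw [koszulExt_apply_of_ne _ hF] at ha
    simp at ha

theorem exists_koszulTensor_eq (hI : ∀ p, p ∈ I ↔ ∀ a, coeff a p ≠ 0 → a ∈ S) {q : ℕ}
    {f : Finset σ → MvPolynomial σ K} (hf : f ∈ koszulPart K S q) :
    ∃ z, koszulTensor I q z = f := by
  have hmem : ∀ F, f F ∈ I := fun F => (hI _).2 fun a ha => (mem_koszulPart.1 hf F a ha).1
  refine ⟨(piScalarRight (MvPolynomial σ K) (MvPolynomial σ K) I _).symm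
    fun F => ⟨f F.1, hmem F.1⟩, ?_⟩
  rw [koszulTensor_apply, LinearEquiv.apply_symm_apply]
  exact koszulExt_koszulRes hf

theorem koszulD_koszulTensor_eq_zero_iff {q : ℕ} (z : I ⊗[MvPolynomial σ K] KoszulTerm K σ q) :
    koszulD K σ (koszulTensor I q z) = 0 ↔
      (koszulDiff K σ q ((ComplexShape.down ℕ).next q)).lTensor I z = 0 := by
  rcases q with - | q
  -- No degree follows `0`, so `next` takes a default value there; the differential out of degree
  -- `0` vanishes whatever that value is.
  · have h : koszulDiff K σ 0 ((ComplexShape.down ℕ).next 0) = 0 := koszulDiff_of_ne (by simp)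
    rw [h, LinearMap.lTensor_zero, LinearMap.zero_apply]
    refine iff_of_true (koszulPart_zero_koszulD (S := Set.univ) ?_) rfl
    rw [koszulTensor_apply]
    exact koszulExt_mem _
  · have h : (ComplexShape.down ℕ).next (q + 1) = q := ChainComplex.next_nat_succ q
    rw [h, koszulD_koszulTensor, map_eq_zero_iff _ (koszulTensor_injective I q)]

theorem criticalCoeff_koszulTensor_eq_zero_iff (hI : ∀ p, p ∈ I ↔ ∀ a, coeff a p ≠ 0 → a ∈ S)
    (hS : IsStableSet S) {q : ℕ} (z : I ⊗[MvPolynomial σ K] KoszulTerm K σ q)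
    (hz : (koszulDiff K σ q ((ComplexShape.down ℕ).next q)).lTensor I z = 0) :
    criticalCoeff K S q (koszulTensor I q z) = 0 ↔
      ∃ y, (koszulDiff K σ ((ComplexShape.down ℕ).prev q) q).lTensor I y = z := by
  rw [← koszulD_koszulTensor_eq_zero_iff] at hz
  have h : (ComplexShape.down ℕ).prev q = q + 1 := ChainComplex.prev ℕ q
  rw [h]
  constructor
  · intro h
    obtain ⟨g, hg, hgz⟩ := exists_koszulD_eq hS (koszulTensor_mem hI q z) hz h
    obtain ⟨y, rfl⟩ := exists_koszulTensor_eq hI hg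
    rw [koszulD_koszulTensor] at hgz
    exact ⟨y, koszulTensor_injective I q hgz⟩
  · rintro ⟨y, rfl⟩
    rw [← koszulD_koszulTensor]
    exact criticalCoeff_koszulD hS (koszulTensor_mem hI (q + 1) y)

theorem criticalCoeff_koszulTensor_smul (q : ℕ) (c : K)
    (z : I ⊗[MvPolynomial σ K] KoszulTerm K σ q) :
    criticalCoeff K S q (koszulTensor I q (algebraMap K (MvPolynomial σ K) c • z)) =
      c • criticalCoeff K S q (koszulTensor I q z) := by
  rw [map_smul, algebraMap_smul, map_smul]

theorem finrank_tor (hI : ∀ p, p ∈ I ↔ ∀ a, coeff a p ≠ 0 → a ∈ S) (hS : IsStableSet S) (q : ℕ) :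
    Module.finrank K ((ModuleCat.restrictScalars (algebraMap K (MvPolynomial σ K))).obj
      (((Tor (ModuleCat.{u} (MvPolynomial σ K)) q).obj (ModuleCat.of (MvPolynomial σ K) I)).obj
        (ModuleCat.of (MvPolynomial σ K) (MvPolynomial σ K ⧸ varIdeal K σ)))) =
      Nat.card (criticalSet S q) := by
  let T := (MonoidalCategory.tensoringLeft (ModuleCat.{u} (MvPolynomial σ K))).obj
    (ModuleCat.of (MvPolynomial σ K) I)
  let C := (T.mapHomologicalComplex (ComplexShape.down ℕ)).obj (koszulComplex K σ)
  let e : ((Tor (ModuleCat.{u} (MvPolynomial σ K)) q).obj (ModuleCat.of (MvPolynomial σ K) I)).obj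
      (ModuleCat.of (MvPolynomial σ K) (MvPolynomial σ K ⧸ varIdeal K σ)) ≅ (C.sc q).homology :=
    (koszulResolution K σ).isoLeftDerivedObj T q
  rw [((ModuleCat.restrictScalars (algebraMap K (MvPolynomial σ K))).mapIso
    e).toLinearEquiv.finrank_eq, ← Module.finrank_eq_nat_card_basis
      (Finsupp.basisSingleOne (R := K) (ι := criticalSet S q))]
  refine finrank_homology (C.sc q)
    ((criticalCoeff K S q).toAddMonoidHom.comp (koszulTensor I q).toAddMonoidHom)
    (criticalCoeff_koszulTensor_smul q) (criticalCoeff_koszulTensor_eq_zero_iff hI hS) ?_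
  intro w
  obtain ⟨f, hf, hfd, rfl⟩ := exists_cycle (K := K) hS w
  obtain ⟨z, rfl⟩ := exists_koszulTensor_eq hI hf
  exact ⟨z, (koszulD_koszulTensor_eq_zero_iff z).1 hfd, rfl⟩

end Tor

/-! ### Lexsegment ideals: stability and Hilbert function -/

section Lexsegment

universe u

variable {K : Type u} [Field K] {n : ℕ}

/-- The exponent vectors of the monomials in an ideal. -/
def exponentSet (I : Ideal (PolyRing K n)) : Set (Fin (n + 1) →₀ ℕ) :=
  {a | monomial a 1 ∈ I}

theorem mem_exponentSet_of_le {I : Ideal (PolyRing K n)} {a b : Fin (n + 1) →₀ ℕ}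
    (ha : a ∈ exponentSet I) (h : a ≤ b) : b ∈ exponentSet I := by
  obtain ⟨c, rfl⟩ := exists_add_of_le h
  have := I.mul_mem_right (monomial c 1) ha
  rwa [monomial_mul, one_mul] at this

theorem IsLexsegment.mem_iff {I : Ideal (PolyRing K n)} (hI : IsLexsegment I) (p : PolyRing K n) :
    p ∈ I ↔ ∀ a, coeff a p ≠ 0 → a ∈ exponentSet I := by
  have h : {p | p ∈ I ∧ ∃ a : Fin (n + 1) →₀ ℕ, p = monomial a 1} =
      (fun a => monomial a (1 : K)) '' exponentSet I := by
    ext p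
    constructor
    · rintro ⟨hp, a, rfl⟩
      exact ⟨a, hp, rfl⟩
    · rintro ⟨a, ha, rfl⟩
      exact ⟨ha, a, rfl⟩
  have h2 := hI.span_monomials
  rw [h] at h2
  conv_lhs => rw [← h2]
  rw [mem_ideal_span_monomial_image]
  refine forall_congr' fun a => ?_
  rw [mem_support_iff]
  refine imp_congr_right fun _ => ⟨?_, fun ha => ⟨a, ha, le_rfl⟩⟩
  rintro ⟨b, hb, hba⟩
  exact mem_exponentSet_of_le hb hba

theorem IsLexsegment.isStableSet {I : Ideal (PolyRing K n)} (hI : IsLexsegment I) :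
    IsStableSet (exponentSet I) where
  add_single a i ha := mem_exponentSet_of_le ha le_self_add
  exchange c i m him h := by
    refine hI.mem_of_lex_le _ _ ?_ ?_ h
    · simp
    · rw [toLex_add, toLex_add]
      -- A smaller index is a lexicographically larger variable, so the exchange moves up.
      exact add_le_add_right (Finsupp.Lex.single_strictAnti.antitone him) _

theorem mem_monomialsOfDegree {d : ℕ} {a : Fin (n + 1) →₀ ℕ} :
    a ∈ monomialsOfDegree n d ↔ a.degree = d := by
  rw [monomialsOfDegree, Finset.mem_finsuppAntidiag, Finsupp.degree_eq_sum]
  simp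

open Classical in
-- A polynomial lies in `I` exactly when all its monomials do, so the classes of the degree `d`
-- monomials outside `I` form a basis of the graded piece of the quotient.
theorem IsLexsegment.hilbertFunction_eq {I : Ideal (PolyRing K n)} (hI : IsLexsegment I) (d : ℕ) :
    hilbertFunction I d = ((monomialsOfDegree n d).filter (· ∉ exponentSet I)).card := by
  set N := (monomialsOfDegree n d).filter (· ∉ exponentSet I)
  let v : N → PolyRing K n ⧸ I := fun a => Ideal.Quotient.mk I (monomial a.1 1)
  have hspan : (homogeneousSubmodule (Fin (n + 1)) K d).map
      (Ideal.Quotient.mkₐ K I).toLinearMap = Submodule.span K (Set.range v) := by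
    apply le_antisymm
    · rw [Submodule.map_le_iff_le_comap]
      intro p hp
      rw [Submodule.mem_comap, p.as_sum, map_sum]
      refine Submodule.sum_mem _ fun a ha => ?_
      have hdeg : a ∈ monomialsOfDegree n d := by
        rw [mem_monomialsOfDegree]
        exact (Finsupp.degree_eq_weight_one (R := ℕ) ▸ hp (mem_support_iff.1 ha))
      have hm : monomial a (coeff a p) = coeff a p • monomial a (1 : K) := by
        rw [smul_monomial, smul_eq_mul, mul_one]
      rw [hm, map_smul]
      refine Submodule.smul_mem _ _ ?_
      by_cases haS : a ∈ exponentSet I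
      · have : (Ideal.Quotient.mkₐ K I).toLinearMap (monomial a (1 : K)) = 0 :=
          Ideal.Quotient.eq_zero_iff_mem.2 haS
        rw [this]
        exact zero_mem _
      · exact Submodule.subset_span ⟨⟨a, Finset.mem_filter.2 ⟨hdeg, haS⟩⟩, rfl⟩
    · rw [Submodule.span_le]
      rintro _ ⟨a, rfl⟩
      refine ⟨monomial a.1 1, ?_, rfl⟩
      exact isHomogeneous_monomial _ (mem_monomialsOfDegree.1 (Finset.mem_filter.1 a.2).1)
  have hli : LinearIndependent K v := by
    rw [Fintype.linearIndependent_iff]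
    intro g hg a
    have hg' : Ideal.Quotient.mk I (∑ b : N, monomial b.1 (g b)) = 0 := by
      rw [map_sum, ← hg]
      refine Finset.sum_congr rfl fun b _ => ?_
      have hm : monomial b.1 (g b) = g b • monomial b.1 (1 : K) := by
        rw [smul_monomial, smul_eq_mul, mul_one]
      rw [hm]
      rfl
    rw [Ideal.Quotient.eq_zero_iff_mem, hI.mem_iff] at hg'
    by_contra ha
    refine (Finset.mem_filter.1 a.2).2 (hg' a.1 ?_)
    rw [coeff_sum, Finset.sum_eq_single a]
    · rwa [coeff_monomial, if_pos rfl]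
    · intro b _ hb
      rw [coeff_monomial, if_neg fun h => hb (Subtype.ext h)]
    · simp
  rw [hilbertFunction, hspan, finrank_span_eq_card hli, Fintype.card_coe]

open Classical in
-- The monomials outside `I` form a lexicographic lower set. For `a` outside `I`, everything smaller
-- lies in this set without `a`, hence strictly fewer elements; for `a` in `I`, the whole set lies
-- below `a`.
theorem IsLexsegment.filter_notMem_eq_lastMonomials {I : Ideal (PolyRing K n)}
    (hI : IsLexsegment I) (d : ℕ) :
    (monomialsOfDegree n d).filter (· ∉ exponentSet I) =
      lastMonomials n d (hilbertFunction I d) := by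
  rw [hI.hilbertFunction_eq]
  ext a
  simp only [lastMonomials, Finset.mem_filter, and_congr_right_iff]
  intro ha
  constructor
  · intro haS
    refine Finset.card_lt_card ⟨fun b hb => ?_, fun h => ?_⟩
    · rw [Finset.mem_filter] at hb ⊢
      refine ⟨hb.1, fun hbS => haS (hI.mem_of_lex_le b a ?_ hb.2.le hbS)⟩
      rw [mem_monomialsOfDegree.1 hb.1, mem_monomialsOfDegree.1 ha]
    · have := h (Finset.mem_filter.2 ⟨ha, haS⟩)
      exact lt_irrefl _ (Finset.mem_filter.1 this).2
  · intro h haS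
    refine h.not_ge (Finset.card_le_card fun b hb => ?_)
    rw [Finset.mem_filter] at hb ⊢
    refine ⟨hb.1, ?_⟩
    by_contra hab
    refine hb.2 (hI.mem_of_lex_le a b ?_ (not_lt.1 hab) haS)
    rw [mem_monomialsOfDegree.1 hb.1, mem_monomialsOfDegree.1 ha]

theorem IsLexsegment.betti_eq {I : Ideal (PolyRing K n)} (hI : IsLexsegment I) (q : ℕ) :
    betti q I = Nat.card (criticalSet (exponentSet I) q) :=
  finrank_tor hI.mem_iff hI.isStableSet q

end Lexsegment

/-! ### Counting unmatched elements and minimal generators -/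

section Counting

variable {n : ℕ}

theorem maxi_add_single {m : Fin (n + 1)} {c : Fin (n + 1) →₀ ℕ} (hm : BoundedBy m c) :
    maxi (c + Finsupp.single m 1) = m := by
  refine le_antisymm (Finset.sup_le fun j hj => ?_) ?_
  · exact hm.add_single le_rfl j (Finsupp.mem_support_iff.1 hj)
  · exact Finset.le_sup (f := fun i : Fin (n + 1) => (i : ℕ)) (Finsupp.mem_support_iff.2 (by simp))

theorem boundedBy_iff {m : Fin (n + 1)} {c : Fin (n + 1) →₀ ℕ} :
    BoundedBy m c ↔ maxi c ≤ m := by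
  rw [maxi, Finset.sup_le_iff]
  exact forall_congr' fun j => by rw [Finsupp.mem_support_iff, Fin.le_def]

theorem maxi_le (a : Fin (n + 1) →₀ ℕ) : maxi a ≤ n :=
  Finset.sup_le fun j _ => by omega

/-- The minimal generators of the stable ideal spanned by `S`. -/
def minGens (S : Set (Fin (n + 1) →₀ ℕ)) : Set (Fin (n + 1) →₀ ℕ) :=
  {a | a ∈ S ∧ ∀ m c, BoundedBy m c → a = c + Finsupp.single m 1 → c ∉ S}

theorem mem_criticalSet_iff {S : Set (Fin (n + 1) →₀ ℕ)} {q : ℕ} {F : Finset (Fin (n + 1))}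
    {a : Fin (n + 1) →₀ ℕ} : (⟨F, a⟩ : Σ _ : Finset (Fin (n + 1)), Fin (n + 1) →₀ ℕ) ∈
      criticalSet S q ↔ a ∈ minGens S ∧
        F ∈ (Finset.univ.filter fun i : Fin (n + 1) => (i : ℕ) < maxi a).powersetCard q := by
  have hdef : (⟨F, a⟩ : Σ _ : Finset (Fin (n + 1)), Fin (n + 1) →₀ ℕ) ∈ criticalSet S q ↔
      a ∈ S ∧ F.card = q ∧ ¬ IsMatched S ⟨F, a⟩ := Iff.rfl
  have hF : F ⊆ (Finset.univ.filter fun i : Fin (n + 1) => (i : ℕ) < maxi a) ↔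
      ∀ j ∈ F, (j : ℕ) < maxi a :=
    forall₂_congr fun j _ => by simp
  rw [hdef, Finset.mem_powersetCard, hF, minGens, Set.mem_ofPred_eq]
  by_cases haS : a ∈ S
  swap
  · simp [haS]
  -- The convention `maxi 0 = 0` leaves only `F = ∅` here, in agreement with `isMatched_zero_iff`.
  by_cases ha : a = 0
  · subst ha
    rw [isMatched_zero_iff haS, Finset.not_nonempty_iff_eq_empty]
    constructor
    · rintro ⟨h0, h1, rfl⟩
      refine ⟨⟨h0, fun m c _ h => ?_⟩, by simp, h1⟩
      simpa using DFunLike.congr_fun h m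
    · rintro ⟨⟨h0, _⟩, h1, h2⟩
      refine ⟨h0, h2, Finset.eq_empty_of_forall_notMem fun j hj => ?_⟩
      simpa [maxi] using h1 j hj
  · obtain ⟨m, c, hm, rfl⟩ := exists_eq_add_single ha
    rw [isMatched_add_single_iff hm haS, maxi_add_single hm]
    push Not
    constructor
    · rintro ⟨h0, h1, h2, h3⟩
      refine ⟨⟨h0, fun m' c' hm' h => ?_⟩, h2, h1⟩
      obtain ⟨-, rfl⟩ := hm.eq_of_add_single_eq hm' h
      exact h3
    · rintro ⟨⟨h0, h3⟩, h2, h1⟩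
      exact ⟨h0, h1, h2, h3 m c hm rfl⟩

/-- By Dickson's lemma an antichain of exponents is finite. If a generator `b` properly divided `a`,
then `a` would be `x_i` times an element of `S`, and by stability `a` divided by its last variable
would lie in `S`. -/
theorem finite_minGens {S : Set (Fin (n + 1) →₀ ℕ)} (hS : IsStableSet S) :
    (minGens S).Finite := by
  have hup : ∀ b c, b ∈ S → b + c ∈ S := by
    intro b c hb
    induction c using Finsupp.induction_linear generalizing b with
    | zero => simpa
    | add f g hf hg => rw [← add_assoc]; exact hg _ (hf _ hb)
    | single i k =>
      induction k with
      | zero => simpa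
      | succ k ih => rw [Finsupp.single_add, ← add_assoc]; exact hS.add_single _ _ ih
  refine WellQuasiOrderedLE.finite_of_isAntichain fun b hb a ha hne hle => ?_
  obtain ⟨e, rfl⟩ := exists_add_of_le hle
  have he : e ≠ 0 := by rintro rfl; simp at hne
  obtain ⟨i, f, -, rfl⟩ := exists_eq_add_single he
  have hbf : b + f ∈ S := hup _ _ hb.1
  have ha0 : b + (f + Finsupp.single i 1) ≠ 0 := fun h => by
    simpa using DFunLike.congr_fun h i
  obtain ⟨m, c, hm, h⟩ := exists_eq_add_single ha0
  refine ha.2 m c hm h ?_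
  rw [← add_assoc] at h
  exact hS.mem_of_add_single_eq hm hbf h

open Classical in
/-- The contribution to the `q`-th Betti number of the generators of degree `d`. -/
def genSum (S : Set (Fin (n + 1) →₀ ℕ)) (q d : ℕ) : ℕ :=
  ∑ a ∈ monomialsOfDegree n d with a ∈ minGens S, (maxi a).choose q

theorem exists_card_criticalSet {S : Set (Fin (n + 1) →₀ ℕ)} (hS : IsStableSet S) (q : ℕ) :
    ∃ N₀, ∀ N ≥ N₀, Nat.card (criticalSet S q) = ∑ d ∈ Finset.range N, genSum S q d := by
  classical
  set G := (finite_minGens hS).toFinset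
  refine ⟨G.sup Finsupp.degree + 1, fun N hN => ?_⟩
  let T := G.sigma fun a =>
    (Finset.univ.filter fun i : Fin (n + 1) => (i : ℕ) < maxi a).powersetCard q
  have e : criticalSet S q ≃ T :=
    { toFun := fun x => ⟨⟨x.1.2, x.1.1⟩, by
        have h := mem_criticalSet_iff.1 x.2
        exact Finset.mem_sigma.2 ⟨(Set.Finite.mem_toFinset _).2 h.1, h.2⟩⟩
      invFun := fun x => ⟨⟨x.1.2, x.1.1⟩, mem_criticalSet_iff.2 (by
        have h := Finset.mem_sigma.1 x.2
        exact ⟨(Set.Finite.mem_toFinset _).1 h.1, h.2⟩)⟩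
      left_inv := fun _ => rfl
      right_inv := fun _ => rfl }
  have hdeg : ∀ a ∈ G, a.degree ∈ Finset.range N := fun a ha => by
    have := Finset.le_sup (f := Finsupp.degree) ha
    rw [Finset.mem_range]
    omega
  rw [Nat.card_congr e, Nat.card_eq_fintype_card, Fintype.card_coe, Finset.card_sigma,
    ← Finset.sum_fiberwise_of_maps_to hdeg]
  refine Finset.sum_congr rfl fun d _ => ?_
  rw [genSum]
  refine Finset.sum_congr ?_ fun a _ => ?_
  · ext a
    simp [G, mem_monomialsOfDegree, and_comm]
  · rw [Finset.card_powersetCard, Fin.card_filter_val_lt,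
      min_eq_right ((maxi_le a).trans n.le_succ)]

/-- The hockey-stick identity; it sums the contributions of the multiples `c * x_m` with `m ≥ maxi
c`. -/
theorem sum_choose_ge {k : ℕ} (hk : k ≤ n) (q : ℕ) :
    ((∑ m : Fin (n + 1) with k ≤ m.val, m.val.choose q : ℕ) : ℤ) =
      (n + 1).choose (q + 1) - k.choose (q + 1) := by
  have h1 : ∑ m : Fin (n + 1) with k ≤ m.val, m.val.choose q =
      ∑ m ∈ Finset.Ico k (n + 1), m.choose q := by
    rw [Finset.sum_filter, Fin.sum_univ_eq_sum_range (fun m => if k ≤ m then m.choose q else 0),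
      ← Finset.sum_filter]
    refine Finset.sum_congr ?_ fun _ _ => rfl
    ext m
    simp [and_comm]
  have h2 : ∀ N, k ≤ N → ((∑ m ∈ Finset.Ico k N, m.choose q : ℕ) : ℤ) =
      N.choose (q + 1) - k.choose (q + 1) := by
    intro N hN
    induction N, hN using Nat.le_induction with
    | base => simp
    | succ N hN ih =>
      rw [Finset.sum_Ico_succ_top hN, Nat.cast_add, ih, Nat.choose_succ_succ' N q]
      push_cast
      ring
  rw [h1, h2 _ (by omega)]

open Classical in
theorem genSum_zero (S : Set (Fin (n + 1) →₀ ℕ)) (q : ℕ) :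
    genSum S q 0 = ∑ a ∈ monomialsOfDegree n 0 with a ∈ S, (maxi a).choose q := by
  rw [genSum]
  refine Finset.sum_congr (Finset.filter_congr fun a ha => ?_) fun _ _ => rfl
  refine ⟨fun h => h.1, fun h => ⟨h, fun m c _ hac => ?_⟩⟩
  rw [mem_monomialsOfDegree] at ha
  subst hac
  simp at ha

open Classical in
-- Splitting off the last variable identifies the non-generators of degree `d + 1` in `S` with pairs
-- `(c, m)`, where `c ∈ S` has degree `d` and `m ≥ maxi c`. As `maxi (c * x_m) = m`, summing over
-- `m` for fixed `c` gives the difference of binomials.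
theorem genSum_succ {S : Set (Fin (n + 1) →₀ ℕ)} (hS : IsStableSet S) (q d : ℕ) :
    (genSum S q (d + 1) : ℤ) + ∑ a ∈ monomialsOfDegree n d with a ∈ S,
      (((n + 1).choose (q + 1) : ℤ) - (maxi a).choose (q + 1)) =
    ∑ a ∈ monomialsOfDegree n (d + 1) with a ∈ S, ((maxi a).choose q : ℤ) := by
  have h1 : ∑ a ∈ monomialsOfDegree n d with a ∈ S,
      (((n + 1).choose (q + 1) : ℤ) - (maxi a).choose (q + 1)) =
      ∑ a ∈ monomialsOfDegree n (d + 1) with (a ∈ S ∧ a ∉ minGens S), ((maxi a).choose q : ℤ) := by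
    simp_rw [← sum_choose_ge (maxi_le _), Nat.cast_sum]
    rw [Finset.sum_sigma']
    refine Finset.sum_bij (fun x _ => x.1 + Finsupp.single x.2 1) ?_ ?_ ?_ ?_
    · rintro ⟨c, m⟩ h
      simp only [Finset.mem_sigma, Finset.mem_filter, mem_monomialsOfDegree, Finset.mem_univ,
        true_and] at h
      simp only [Finset.mem_filter, mem_monomialsOfDegree]
      refine ⟨by simp [h.1.1], hS.add_single _ _ h.1.2, fun hmin => ?_⟩
      exact hmin.2 m c (boundedBy_iff.2 h.2) rfl h.1.2
    · rintro ⟨c, m⟩ h ⟨c', m'⟩ h' heq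
      simp only [Finset.mem_sigma, Finset.mem_filter, Finset.mem_univ, true_and] at h h'
      obtain ⟨rfl, rfl⟩ := (boundedBy_iff.2 h.2).eq_of_add_single_eq (boundedBy_iff.2 h'.2) heq
      rfl
    · intro a ha
      simp only [Finset.mem_filter, mem_monomialsOfDegree, minGens, Set.mem_ofPred_eq, not_and,
        not_forall, not_not] at ha
      obtain ⟨m, c, hm, rfl, hc⟩ := ha.2.2 ha.2.1
      refine ⟨⟨c, m⟩, ?_, rfl⟩
      simp only [Finset.mem_sigma, Finset.mem_filter, mem_monomialsOfDegree, Finset.mem_univ,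
        true_and]
      exact ⟨⟨by simpa using ha.1, hc⟩, boundedBy_iff.1 hm⟩
    · rintro ⟨c, m⟩ h
      simp only [Finset.mem_sigma, Finset.mem_filter, Finset.mem_univ, true_and] at h
      rw [maxi_add_single (boundedBy_iff.2 h.2)]
  rw [h1, genSum, Nat.cast_sum, ← Finset.filter_filter,
    ← Finset.sum_filter_add_sum_filter_not ((monomialsOfDegree n (d + 1)).filter (· ∈ S))
      (· ∈ minGens S)]
  congr 1
  rw [Finset.filter_filter]
  refine Finset.sum_congr (Finset.filter_congr fun a _ => ?_) fun _ _ => rfl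
  exact ⟨fun h => ⟨h.1, h⟩, fun h => h.2⟩

open Classical in
-- Summing `genSum_succ` over degrees, each degree below `N` enters once positively and once
-- negatively. Pascal's rule merges the two contributions, turning `maxi a` into `maxi a + 1` in the
-- binomial; only degree `N` is left over.
theorem sum_genSum {S : Set (Fin (n + 1) →₀ ℕ)} (hS : IsStableSet S) (q N : ℕ) :
    ((∑ d ∈ Finset.range (N + 1), genSum S q d : ℕ) : ℤ) =
      ∑ a ∈ monomialsOfDegree n N with a ∈ S, ((maxi a).choose q : ℤ) -
      ∑ d ∈ Finset.range N, ∑ a ∈ monomialsOfDegree n d with a ∈ S,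
        (((n + 1).choose (q + 1) : ℤ) - (maxi a + 1).choose (q + 1)) := by
  induction N with
  | zero => simp [genSum_zero]
  | succ N ih =>
    rw [Finset.sum_range_succ, Nat.cast_add, ih, ← genSum_succ hS, Finset.sum_range_succ _ N]
    have : ∑ a ∈ monomialsOfDegree n N with a ∈ S,
        (((n + 1).choose (q + 1) : ℤ) - (maxi a + 1).choose (q + 1)) =
        ∑ a ∈ monomialsOfDegree n N with a ∈ S,
          (((n + 1).choose (q + 1) : ℤ) - (maxi a).choose (q + 1)) -
        ∑ a ∈ monomialsOfDegree n N with a ∈ S, ((maxi a).choose q : ℤ) := by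
      rw [← Finset.sum_sub_distrib]
      refine Finset.sum_congr rfl fun a _ => ?_
      rw [Nat.choose_succ_succ' (maxi a) q]
      push_cast
      ring
    rw [this]
    ring

end Counting

/-! ### Betti numbers of lexsegment ideals in terms of `V` -/

section Lexsegment

universe u

variable {K : Type u} [Field K] {n : ℕ}

open Classical in
/-- Up to a term that depends only on `n`, `q`, `N` and the Hilbert function in degree `N`, the
Betti number is a sum of the numbers `V` for the degrees below `N`. -/
theorem IsLexsegment.exists_betti_eq {I : Ideal (PolyRing K n)} (hI : IsLexsegment I) (q : ℕ) :
    ∃ N₀, ∀ N ≥ N₀, (betti q I : ℤ) =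
      (∑ a ∈ monomialsOfDegree n N \ lastMonomials n N (hilbertFunction I N),
        ((maxi a).choose q : ℤ)) -
      (∑ d ∈ Finset.range N, ∑ a ∈ monomialsOfDegree n d,
        (((n + 1).choose (q + 1) : ℤ) - (maxi a + 1).choose (q + 1))) +
      ∑ d ∈ Finset.range N, V n q d (hilbertFunction I d) := by
  obtain ⟨N₀, h⟩ := exists_card_criticalSet hI.isStableSet q
  refine ⟨N₀, fun N hN => ?_⟩
  rw [hI.betti_eq, h (N + 1) (by omega), sum_genSum hI.isStableSet, sub_add,
    ← Finset.sum_sub_distrib]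
  congr 1
  · refine Finset.sum_congr ?_ fun _ _ => rfl
    rw [← hI.filter_notMem_eq_lastMonomials]
    ext a
    simp only [Finset.mem_filter, Finset.mem_sdiff]
    tauto
  · refine Finset.sum_congr rfl fun d _ => ?_
    -- The sum over `S` is the sum over all monomials minus the sum over the complement of `S`,
    -- which is `V`.
    rw [V, ← hI.filter_notMem_eq_lastMonomials, eq_sub_iff_add_eq]
    exact Finset.sum_filter_add_sum_filter_not _ _ _

end Lexsegment

end LexBetti

end

/-- `L` and `L'` are the lexsegment ideals with Hilbert functions `h` and `h'`. The natural
numbers `d < (D + 1).toNat` are those with `0 ≤ d ≤ D` (none if `D < 0`). -/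
theorem mainTheorem3 {K : Type*} [Field K] (n : ℕ) (h h' : ℕ → ℕ)
    (L L' : Ideal (LexBetti.PolyRing K n))
    (hL : LexBetti.IsLexsegment L) (hLh : ∀ d, LexBetti.hilbertFunction L d = h d)
    (hL' : LexBetti.IsLexsegment L') (hLh' : ∀ d, LexBetti.hilbertFunction L' d = h' d)
    (D : ℤ) (hD : ∀ d : ℕ, D < (d : ℤ) → h d = h' d) (q : ℕ) :
    (LexBetti.betti q L : ℤ) = (LexBetti.betti q L' : ℤ)
      + ∑ d ∈ Finset.range (D + 1).toNat, LexBetti.V n q d (h d)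
      - ∑ d ∈ Finset.range (D + 1).toNat, LexBetti.V n q d (h' d) := by
  obtain ⟨N₁, h1⟩ := hL.exists_betti_eq q
  obtain ⟨N₂, h2⟩ := hL'.exists_betti_eq q
  -- The degree `N` is past all generators of both ideals, and beyond `D`, so that `h N = h' N` and
  -- the terms in degree `N` cancel.
  obtain ⟨N, hN1, hN2, hN3⟩ : ∃ N, N₁ ≤ N ∧ N₂ ≤ N ∧ (D + 1).toNat ≤ N :=
    ⟨N₁ + N₂ + (D + 1).toNat, by omega, by omega, by omega⟩
  have htail : ∑ d ∈ Finset.Ico (D + 1).toNat N, LexBetti.V n q d (h d) =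
      ∑ d ∈ Finset.Ico (D + 1).toNat N, LexBetti.V n q d (h' d) := by
    refine Finset.sum_congr rfl fun d hd => ?_
    rw [hD d (by have := (Finset.mem_Ico.1 hd).1; omega)]
  simp only [hLh, hLh'] at h1 h2
  rw [h1 N hN1, h2 N hN2, hD N (by omega),
    ← Finset.sum_range_add_sum_Ico (fun d => LexBetti.V n q d (h d)) hN3,
    ← Finset.sum_range_add_sum_Ico (fun d => LexBetti.V n q d (h' d)) hN3, htail]
  ring
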